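/- Let $\xi>0$ and let $G_\xi(dm)=\xi m^{-\xi-1}1_{\{m>0\}}\,dm$. Let $\Phi$ be a Poisson point process on $\mathbb R^d\times(0,+\infty)$ with intensity $dx\,G_\xi(dm)$, defined on a probability space $(\Omega,\mathcal F,\mathbb P)$. Let $h:\mathbb R^d\to[0,+\infty]$ be continuous. For $A\subset\mathbb R^d$ put $h_A(x)=\sup_{z\in A}h(x+z)$ (with $\sup\emptyset=0$), and let $h^+=h_{\{|z|\le 1\}}$. Suppose that $$\int_{\mathbb R^d}h(x)^\xi\,dx=1\qquad\text{and}\qquad\int_{\mathbb R^d}h^+(x)^\xi\,dx<+\infty .$$ Let $M_\infty(y)=\sup\{m\,h(y-x):(x,m)\in\Phi\}$, $y\in\mathbb R^d$, be the associated extremal shot noise, i.e. $M_\infty\sim\mathrm{ESN}(h,G_\xi)$, and let $F_\xi(u)=\exp(-u^{-\xi})1_{\{u>0\}}$. Then the following hold, and all the integrals below are finite. 1. For every compact $K\subset\mathbb R^d$, there is exactly one real number $\theta(K)$ (the extremal coefficient of $K$) such that $\mathbb P[\sup_{x\in K}M_\infty(x)<u]=\mathbb P[M_\infty(0)<u]^{\theta(K)}$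 for all $u>0$, and $$\theta(K)=\int_{\mathbb R^d}h_K(x)^\xi\,dx .$$ 2. In particular, for every $l\in\mathbb R^d$ there is exactly one real number $\theta(l)$ (the extremal coefficient function at lag $l$) such that $\mathbb P[M_\infty(x)<u,\,M_\infty(x+l)<u]=\mathbb P[M_\infty(0)<u]^{\theta(l)}$ for all $x\in\mathbb R^d$ and $u>0$, and $$\theta(l)=\int_{\mathbb R^d}\bigl(h(x)^\xi\vee h(x+l)^\xi\bigr)\,dx .$$ 3. For every $v\in\mathbb R^d\setminus\{0\}$ there is exactly one real number $\gamma(v)$ (the extremal index in direction $v$) such that $\lim_{n\to+\infty}\mathbb P\bigl(\bigvee_{1\le i\le n}M_\infty(iv)\le n^{1/\xi}u\bigr)=F_\xi(u)^{\gamma(v)}$ for all $u>0$, and $$\gamma(v)=\inf_{n\ge1}\frac1n\int_{\mathbb R^d}\bigvee_{k=1}^n h(x+kv)^\xi\,dx .$$ -/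

import Mathlib

open MeasureTheory ProbabilityTheory Filter Topology
open scoped ENNReal

noncomputable section

/-- A Poisson point process on `ℝ^d × (0, ∞)` with intensity `dx G(dm)`, where `G` is a measure
carried by `(0, ∞)`: a random locally finite subset of `ℝ^d × (0, ∞)` whose counts on Borel sets are
measurable, Poisson distributed with the prescribed mean (almost surely infinite if the mean is
infinite), and independent over disjoint sets. -/
structure IsPoissonPointProcess {Ω : Type*} [MeasurableSpace Ω] (P : Measure Ω) {d : ℕ}
    (G : Measure ℝ) (Φ : Ω → Set (EuclideanSpace ℝ (Fin d) × ℝ)) : Prop where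
  mark_pos : ∀ ω, ∀ φ ∈ Φ ω, 0 < φ.2
  locallyFinite : ∀ ω, ∀ C : Set (EuclideanSpace ℝ (Fin d) × ℝ), IsCompact C →
    (∀ φ ∈ C, 0 < φ.2) → (Φ ω ∩ C).Finite
  measurable_count : ∀ A : Set (EuclideanSpace ℝ (Fin d) × ℝ), MeasurableSet A →
    Measurable fun ω => (Φ ω ∩ A).encard
  count_law : ∀ A : Set (EuclideanSpace ℝ (Fin d) × ℝ), MeasurableSet A →
    (volume.prod G) A ≠ ⊤ →
    P.map (fun ω => (Φ ω ∩ A).encard) =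
      (poissonMeasure ((volume.prod G) A).toNNReal).map (fun k : ℕ => (k : ℕ∞))
  count_top : ∀ A : Set (EuclideanSpace ℝ (Fin d) × ℝ), MeasurableSet A →
    (volume.prod G) A = ⊤ → ∀ᵐ ω ∂P, (Φ ω ∩ A).encard = ⊤
  count_indep : ∀ (n : ℕ) (A : Fin n → Set (EuclideanSpace ℝ (Fin d) × ℝ)),
    (∀ i, MeasurableSet (A i)) → Pairwise (Function.onFun Disjoint A) →
    iIndepFun (fun i ω => (Φ ω ∩ A i).encard) P

/-- The extremal shot noise `M(y) = sup {m h(y - x) ; (x, m) ∈ Φ}`, with values in `[0, ∞]`. -/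
def extremalShotNoise {Ω : Type*} {d : ℕ} (h : EuclideanSpace ℝ (Fin d) → ℝ≥0∞)
    (Φ : Ω → Set (EuclideanSpace ℝ (Fin d) × ℝ)) (ω : Ω) (y : EuclideanSpace ℝ (Fin d)) : ℝ≥0∞ :=
  ⨆ φ ∈ Φ ω, ENNReal.ofReal φ.2 * h (y - φ.1)

/-- The measure `G_ξ(dm) = ξ m^(-ξ-1) 1_{m > 0} dm`. -/
def powerMeasure (ξ : ℝ) : Measure ℝ :=
  (volume.restrict (Set.Ioi 0)).withDensity fun m => ENNReal.ofReal (ξ * m ^ (-ξ - 1))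

/-- The Fréchet distribution function `F_ξ(u) = exp(-u^(-ξ)) 1_{u > 0}`. -/
def frechetCDF (ξ u : ℝ) : ℝ :=
  if 0 < u then Real.exp (-u ^ (-ξ)) else 0

/-- `h_A(x) = sup {h(x + z) ; z ∈ A}`. -/
def supOver {d : ℕ} (h : EuclideanSpace ℝ (Fin d) → ℝ≥0∞) (A : Set (EuclideanSpace ℝ (Fin d)))
    (x : EuclideanSpace ℝ (Fin d)) : ℝ≥0∞ :=
  ⨆ z ∈ A, h (x + z)

/-- `θ` is an extremal coefficient of the random field `M` on the set `K`. -/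
def IsExtremalCoefficient {Ω : Type*} [MeasurableSpace Ω] (P : Measure Ω) {d : ℕ}
    (M : Ω → EuclideanSpace ℝ (Fin d) → ℝ≥0∞) (K : Set (EuclideanSpace ℝ (Fin d))) (θ : ℝ) : Prop :=
  ∀ u : ℝ, 0 < u →
    P.real {ω | (⨆ x ∈ K, M ω x) < ENNReal.ofReal u} = P.real {ω | M ω 0 < ENNReal.ofReal u} ^ θ

/-- `θ` is a value at lag `l` of the (pairwise) extremal coefficient function of `M`. -/
def IsPairwiseExtremalCoefficient {Ω : Type*} [MeasurableSpace Ω] (P : Measure Ω) {d : ℕ}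
    (M : Ω → EuclideanSpace ℝ (Fin d) → ℝ≥0∞) (l : EuclideanSpace ℝ (Fin d)) (θ : ℝ) : Prop :=
  ∀ (x : EuclideanSpace ℝ (Fin d)) (u : ℝ), 0 < u →
    P.real {ω | M ω x < ENNReal.ofReal u ∧ M ω (x + l) < ENNReal.ofReal u} =
      P.real {ω | M ω 0 < ENNReal.ofReal u} ^ θ

/-- `γ` is an extremal index, in the direction `v`, of a random field `M` with Fréchet margins
`F_ξ`. -/
def IsExtremalIndex {Ω : Type*} [MeasurableSpace Ω] (P : Measure Ω) {d : ℕ} (ξ : ℝ)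
    (M : Ω → EuclideanSpace ℝ (Fin d) → ℝ≥0∞) (v : EuclideanSpace ℝ (Fin d)) (γ : ℝ) : Prop :=
  ∀ u : ℝ, 0 < u →
    Tendsto
      (fun n : ℕ =>
        P.real {ω | (⨆ i ∈ Finset.Icc 1 n, M ω (i • v)) ≤ ENNReal.ofReal ((n : ℝ) ^ (1 / ξ) * u)})
      atTop (𝓝 (frechetCDF ξ u ^ γ))

end

/-! A supremum of the field over `K` is at most `u` exactly when no point `(x, m)` of `Φ` satisfies
`m h_K(-x) > u`. By Tonelli and the tail `a ^ (-ξ)` of the marks, the set of such points has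
intensity `u ^ (-ξ) ∫ h_K ^ ξ`, so the void probability is `exp (-u ^ (-ξ) ∫ h_K ^ ξ)`
(`measureReal_iSup_le`, and `measureReal_iSup_lt` for the strict event). All three claims are
choices of `K`: `{0}` gives the Fréchet margin, `{x, x + l}` the pairs, and `{v, ..., nv}` at level
`n ^ (1/ξ) u` gives `exp (-u ^ (-ξ) I n / n)`. Since `I` is subadditive by translation invariance,
Fekete's lemma turns the limit of `I n / n` into an infimum. -/

/-! ### Intensity of the exceedances -/

open Set in
theorem powerMeasure_Ioi {ξ : ℝ} (hξ : 0 < ξ) {a : ℝ} (ha : 0 < a) :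
    powerMeasure ξ (Ioi a) = ENNReal.ofReal (a ^ (-ξ)) := by
  have hlt : -ξ - 1 < -1 := by linarith
  rw [powerMeasure, withDensity_apply _ measurableSet_Ioi, Measure.restrict_restrict measurableSet_Ioi,
    Ioi_inter_Ioi, sup_eq_left.2 ha.le, ← ofReal_integral_eq_lintegral_ofReal]
  · rw [integral_const_mul, integral_Ioi_rpow_of_lt hlt ha]
    congr 1
    have : -ξ - 1 + 1 = -ξ := by ring
    rw [this]
    field_simp
  · exact (integrableOn_Ioi_rpow_of_lt hlt ha).const_mul ξ
  · filter_upwards [ae_restrict_mem measurableSet_Ioi] with m hm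
    have : 0 < m := ha.trans hm
    simp only [Pi.zero_apply]
    positivity

-- The tails `a ^ (-ξ)` blow up as `a` tends to `0`. This covers the points where `h` is infinite:
-- there every positive mark exceeds the level.
open Set in
theorem powerMeasure_Ioi_zero {ξ : ℝ} (hξ : 0 < ξ) : powerMeasure ξ (Ioi 0) = ⊤ := by
  refine ENNReal.eq_top_of_forall_nnreal_le fun r => ?_
  have hr : (0 : ℝ) < r + 1 := by positivity
  have ha : (0 : ℝ) < ((r : ℝ) + 1) ^ (-ξ⁻¹) := Real.rpow_pos_of_pos hr _
  calc (r : ℝ≥0∞) ≤ ENNReal.ofReal ((r : ℝ) + 1) := by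
        rw [← ENNReal.ofReal_coe_nnreal]
        exact ENNReal.ofReal_le_ofReal (by linarith)
    _ = powerMeasure ξ (Ioi (((r : ℝ) + 1) ^ (-ξ⁻¹))) := by
        rw [powerMeasure_Ioi hξ ha, ← Real.rpow_mul hr.le]
        congr 1
        rw [neg_mul_neg, inv_mul_cancel₀ hξ.ne', Real.rpow_one]
    _ ≤ powerMeasure ξ (Ioi 0) := measure_mono (Ioi_subset_Ioi ha.le)

/-- Scaling of the power measure: the mass of the marks `m` with `m c > u` is `u^(-ξ) c^ξ`. -/
theorem powerMeasure_mul_gt {ξ : ℝ} (hξ : 0 < ξ) {u : ℝ} (hu : 0 < u) (c : ℝ≥0∞) :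
    powerMeasure ξ {m | 0 < m ∧ ENNReal.ofReal u < ENNReal.ofReal m * c} =
      ENNReal.ofReal (u ^ (-ξ)) * c ^ ξ := by
  have hu' : 0 < u ^ (-ξ) := Real.rpow_pos_of_pos hu _
  induction c with
  | top =>
    rw [ENNReal.top_rpow_of_pos hξ, ENNReal.mul_top (by simpa using hu')]
    refine Eq.trans (congrArg _ ?_) (powerMeasure_Ioi_zero hξ)
    ext m
    simp only [Set.mem_ofPred_eq, Set.mem_Ioi, and_iff_left_iff_imp]
    intro hm
    rw [ENNReal.mul_top (by simpa using hm)]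
    exact ENNReal.ofReal_lt_top
  | coe c =>
    rcases eq_or_ne c 0 with rfl | hc
    · simp [ENNReal.zero_rpow_of_pos hξ]
    · have hc' : (0 : ℝ) < c := by positivity
      have : {m : ℝ | 0 < m ∧ ENNReal.ofReal u < ENNReal.ofReal m * (c : ℝ≥0∞)} =
          Set.Ioi (u / c) := by
        ext m
        simp only [Set.mem_ofPred_eq, Set.mem_Ioi]
        rw [← ENNReal.ofReal_coe_nnreal, div_lt_iff₀ hc']
        constructor
        · rintro ⟨hm, h⟩
          rw [← ENNReal.ofReal_mul hm.le] at h
          exact (ENNReal.ofReal_lt_ofReal_iff_of_nonneg hu.le).1 h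
        · intro h
          have hm : 0 < m := pos_of_mul_pos_left (hu.trans h) hc'.le
          rw [← ENNReal.ofReal_mul hm.le]
          exact ⟨hm, (ENNReal.ofReal_lt_ofReal_iff_of_nonneg hu.le).2 h⟩
      rw [this, powerMeasure_Ioi hξ (by positivity), ← ENNReal.ofReal_coe_nnreal,
        ENNReal.ofReal_rpow_of_pos hc', ← ENNReal.ofReal_mul hu'.le]
      congr 1
      rw [Real.div_rpow hu.le hc'.le, Real.rpow_neg hc'.le, div_inv_eq_mul]

instance sFinite_powerMeasure (ξ : ℝ) : SFinite (powerMeasure ξ) := by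
  unfold powerMeasure
  infer_instance

/-- `A` may be uncountable, but a supremum of continuous functions is lower semicontinuous. -/
theorem measurable_supOver {d : ℕ} {h : EuclideanSpace ℝ (Fin d) → ℝ≥0∞} (hcont : Continuous h)
    (A : Set (EuclideanSpace ℝ (Fin d))) : Measurable (supOver h A) := by
  refine LowerSemicontinuous.measurable ?_
  refine lowerSemicontinuous_biSup fun z _ => ?_
  exact (hcont.comp (continuous_id.add continuous_const)).lowerSemicontinuous

/-- The points `(x, m)` whose contribution to the shot noise over `K` exceeds `u`. -/
def exceedanceSet {d : ℕ} (h : EuclideanSpace ℝ (Fin d) → ℝ≥0∞)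
    (K : Set (EuclideanSpace ℝ (Fin d))) (u : ℝ) : Set (EuclideanSpace ℝ (Fin d) × ℝ) :=
  {φ | 0 < φ.2 ∧ ENNReal.ofReal u < ENNReal.ofReal φ.2 * supOver h K (-φ.1)}

theorem measurableSet_exceedanceSet {d : ℕ} {h : EuclideanSpace ℝ (Fin d) → ℝ≥0∞}
    (hcont : Continuous h) (K : Set (EuclideanSpace ℝ (Fin d))) (u : ℝ) :
    MeasurableSet (exceedanceSet h K u) := by
  have hm : Measurable fun φ : EuclideanSpace ℝ (Fin d) × ℝ =>
      ENNReal.ofReal φ.2 * supOver h K (-φ.1) :=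
    measurable_snd.ennreal_ofReal.mul ((measurable_supOver hcont K).comp measurable_fst.neg)
  have h1 : MeasurableSet {φ : EuclideanSpace ℝ (Fin d) × ℝ | 0 < φ.2} :=
    measurableSet_lt measurable_const measurable_snd
  exact h1.inter (measurableSet_lt (measurable_const (a := ENNReal.ofReal u)) hm)

theorem prod_powerMeasure_exceedanceSet {d : ℕ} {h : EuclideanSpace ℝ (Fin d) → ℝ≥0∞}
    (hcont : Continuous h) (K : Set (EuclideanSpace ℝ (Fin d))) {ξ : ℝ} (hξ : 0 < ξ) {u : ℝ}
    (hu : 0 < u) :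
    (volume.prod (powerMeasure ξ)) (exceedanceSet h K u) =
      ENNReal.ofReal (u ^ (-ξ)) * ∫⁻ x, supOver h K x ^ ξ := by
  rw [Measure.prod_apply (measurableSet_exceedanceSet hcont K u)]
  have : ∀ x, powerMeasure ξ (Prod.mk x ⁻¹' exceedanceSet h K u) =
      ENNReal.ofReal (u ^ (-ξ)) * supOver h K (-x) ^ ξ := fun x =>
    powerMeasure_mul_gt hξ hu (supOver h K (-x))
  simp_rw [this]
  rw [lintegral_const_mul' _ _ ENNReal.ofReal_ne_top,
    lintegral_neg_eq_self (fun x => supOver h K x ^ ξ)]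

/-- The two suprema commute, which reduces an event about the whole field on `K` to a condition on
each point of `Φ` separately. -/
theorem iSup_extremalShotNoise {Ω : Type*} {d : ℕ} (h : EuclideanSpace ℝ (Fin d) → ℝ≥0∞)
    (Φ : Ω → Set (EuclideanSpace ℝ (Fin d) × ℝ)) (ω : Ω) (K : Set (EuclideanSpace ℝ (Fin d))) :
    (⨆ y ∈ K, extremalShotNoise h Φ ω y) =
      ⨆ φ ∈ Φ ω, ENNReal.ofReal φ.2 * supOver h K (-φ.1) := by
  simp only [extremalShotNoise, supOver, ENNReal.mul_iSup]
  refine le_antisymm ?_ ?_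
  · refine iSup₂_le fun y hy => iSup₂_le fun φ hφ => ?_
    refine le_iSup₂_of_le φ hφ (le_iSup₂_of_le y hy ?_)
    rw [sub_eq_neg_add]
  · refine iSup₂_le fun φ hφ => iSup₂_le fun y hy => ?_
    refine le_iSup₂_of_le y hy (le_iSup₂_of_le φ hφ ?_)
    rw [sub_eq_neg_add]

/-! ### Law of the suprema of the shot noise -/

section PoissonProcess

variable {Ω : Type*} [MeasurableSpace Ω] {P : Measure Ω} {d : ℕ}
  {Φ : Ω → Set (EuclideanSpace ℝ (Fin d) × ℝ)}

/-- The void probabilities of a Poisson point process. -/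
theorem IsPoissonPointProcess.measureReal_inter_eq_empty {G : Measure ℝ}
    (hΦ : IsPoissonPointProcess P G Φ) {A : Set (EuclideanSpace ℝ (Fin d) × ℝ)}
    (hA : MeasurableSet A) (hfin : (volume.prod G) A ≠ ⊤) :
    P.real {ω | Φ ω ∩ A = ∅} = Real.exp (-((volume.prod G) A).toReal) := by
  have key : P {ω | Φ ω ∩ A = ∅} = poissonMeasure ((volume.prod G) A).toNNReal {0} := by
    have h0 : MeasurableSet ({0} : Set ℕ∞) := measurableSet_singleton 0
    have h1 := congrArg (fun μ => μ {0}) (hΦ.count_law A hA hfin)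
    simp only [Measure.map_apply (hΦ.measurable_count A hA) h0,
      Measure.map_apply (Measurable.of_discrete (f := fun k : ℕ => (k : ℕ∞))) h0] at h1
    convert h1 using 2
    · ext ω
      simp
    · ext k
      simp
  rw [Measure.real, key, ← Measure.real, poissonMeasure_real_singleton]
  simp [ENNReal.coe_toNNReal_eq_toReal]

variable {ξ : ℝ} {h : EuclideanSpace ℝ (Fin d) → ℝ≥0∞}

theorem IsPoissonPointProcess.measureReal_iSup_le (hΦ : IsPoissonPointProcess P (powerMeasure ξ) Φ)
    (hξ : 0 < ξ) (hcont : Continuous h) {K : Set (EuclideanSpace ℝ (Fin d))}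
    (hK : (∫⁻ x, supOver h K x ^ ξ) < ⊤) {u : ℝ} (hu : 0 < u) :
    P.real {ω | (⨆ y ∈ K, extremalShotNoise h Φ ω y) ≤ ENNReal.ofReal u} =
      Real.exp (-(u ^ (-ξ) * (∫⁻ x, supOver h K x ^ ξ).toReal)) := by
  have hset : {ω | (⨆ y ∈ K, extremalShotNoise h Φ ω y) ≤ ENNReal.ofReal u} =
      {ω | Φ ω ∩ exceedanceSet h K u = ∅} := by
    ext ω
    simp only [Set.mem_ofPred_eq, iSup_extremalShotNoise, iSup_le_iff,
      Set.eq_empty_iff_forall_notMem, Set.mem_inter_iff, exceedanceSet, not_and, not_lt]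
    exact ⟨fun H φ hφ _ => H φ hφ, fun H φ hφ => H φ hφ (hΦ.mark_pos ω φ hφ)⟩
  have hvol := prod_powerMeasure_exceedanceSet hcont K hξ hu
  rw [hset, hΦ.measureReal_inter_eq_empty (measurableSet_exceedanceSet hcont K u), hvol,
    ENNReal.toReal_mul, ENNReal.toReal_ofReal (Real.rpow_nonneg hu.le _)]
  rw [hvol]
  exact ENNReal.mul_ne_top ENNReal.ofReal_ne_top hK.ne

/-- The event `< u` lies inside `≤ u` and contains `≤ t` for every `t < u`; the law of the latter is
continuous in the level, so letting `t` increase to `u` closes the gap. -/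
theorem IsPoissonPointProcess.measureReal_iSup_lt [IsFiniteMeasure P]
    (hΦ : IsPoissonPointProcess P (powerMeasure ξ) Φ)
    (hξ : 0 < ξ) (hcont : Continuous h) {K : Set (EuclideanSpace ℝ (Fin d))}
    (hK : (∫⁻ x, supOver h K x ^ ξ) < ⊤) {u : ℝ} (hu : 0 < u) :
    P.real {ω | (⨆ y ∈ K, extremalShotNoise h Φ ω y) < ENNReal.ofReal u} =
      Real.exp (-(u ^ (-ξ) * (∫⁻ x, supOver h K x ^ ξ).toReal)) := by
  refine le_antisymm ?_ ?_
  · rw [← hΦ.measureReal_iSup_le hξ hcont hK hu]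
    exact measureReal_mono (Set.ofPred_subset_ofPred.2 fun ω hω => hω.le)
  · have hlim : Tendsto (fun t : ℝ => Real.exp (-(t ^ (-ξ) * (∫⁻ x, supOver h K x ^ ξ).toReal)))
        (𝓝[<] u) (𝓝 (Real.exp (-(u ^ (-ξ) * (∫⁻ x, supOver h K x ^ ξ).toReal)))) := by
      have hc : ContinuousAt (fun t : ℝ => t ^ (-ξ)) u :=
        Real.continuousAt_rpow_const u (-ξ) (Or.inl hu.ne')
      exact ((hc.mul continuousAt_const).neg.rexp).tendsto.mono_left nhdsWithin_le_nhds
    refine le_of_tendsto hlim ?_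
    filter_upwards [Ioo_mem_nhdsLT hu] with t ht
    rw [← hΦ.measureReal_iSup_le hξ hcont hK ht.1]
    exact measureReal_mono fun ω hω =>
      lt_of_le_of_lt hω ((ENNReal.ofReal_lt_ofReal_iff hu).2 ht.2)

end PoissonProcess

/-! ### Finiteness and subadditivity of the integrals -/

/-- Finitely many unit balls cover `K`, so `h_K ^ ξ` is bounded by a finite sum of translates of
`(h⁺) ^ ξ`, each with the same finite integral. -/
theorem lintegral_supOver_rpow_lt_top {d : ℕ} {h : EuclideanSpace ℝ (Fin d) → ℝ≥0∞} {ξ : ℝ}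
    (hξ : 0 < ξ) (hplus : (∫⁻ x, supOver h (Metric.closedBall 0 1) x ^ ξ) < ⊤)
    (hcont : Continuous h) {K : Set (EuclideanSpace ℝ (Fin d))} (hK : IsCompact K) :
    (∫⁻ x, supOver h K x ^ ξ) < ⊤ := by
  obtain ⟨t, -, htfin, ht⟩ := hK.finite_cover_balls one_pos
  lift t to Finset (EuclideanSpace ℝ (Fin d)) using htfin
  set g := supOver h (Metric.closedBall 0 1)
  have hgm : Measurable g := measurable_supOver hcont _
  have hle : ∀ x, supOver h K x ^ ξ ≤ ∑ z ∈ t, g (x + z) ^ ξ := by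
    intro x
    rw [← ENNReal.le_rpow_inv_iff hξ]
    refine iSup₂_le fun y hy => ?_
    rw [ENNReal.le_rpow_inv_iff hξ]
    obtain ⟨z, hz, hyz⟩ := Set.mem_iUnion₂.1 (ht hy)
    refine le_trans ?_ (Finset.single_le_sum (f := fun z => g (x + z) ^ ξ)
      (fun _ _ => zero_le) hz)
    refine ENNReal.rpow_le_rpow ?_ hξ.le
    refine le_iSup₂_of_le (y - z) ?_ (le_of_eq (by congr 1; abel))
    rw [mem_closedBall_zero_iff, ← dist_eq_norm]
    exact (Metric.mem_ball.1 hyz).le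
  refine (lintegral_mono hle).trans_lt ?_
  have hm : ∀ z ∈ t, Measurable fun x => g (x + z) ^ ξ := fun z _ =>
    (hgm.comp (measurable_id.add_const z)).pow_const ξ
  rw [lintegral_finsetSum _ hm]
  refine ENNReal.sum_lt_top.2 fun z _ => ?_
  rw [lintegral_add_right_eq_self (fun x => g x ^ ξ) z]
  exact hplus

/-- For `ξ > 0` the power is an order automorphism of `[0, ∞]`, hence commutes with all suprema, the
empty one included. -/
theorem supOver_rpow {d : ℕ} (h : EuclideanSpace ℝ (Fin d) → ℝ≥0∞) {ξ : ℝ} (hξ : 0 < ξ)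
    (A : Set (EuclideanSpace ℝ (Fin d))) (x : EuclideanSpace ℝ (Fin d)) :
    supOver h A x ^ ξ = supOver (fun y => h y ^ ξ) A x := by
  have := (ENNReal.orderIsoRpow ξ hξ).map_iSup₂ fun z (_ : z ∈ A) => h (x + z)
  simpa only [ENNReal.orderIsoRpow_apply, supOver] using this

theorem supOver_pair {d : ℕ} (h : EuclideanSpace ℝ (Fin d) → ℝ≥0∞)
    (y z x : EuclideanSpace ℝ (Fin d)) :
    supOver h {y, z} x = max (h (x + y)) (h (x + z)) := by
  simp only [supOver, iSup_pair]

/-- The first `n` positive multiples of `v`. -/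
def multiples {d : ℕ} (v : EuclideanSpace ℝ (Fin d)) (n : ℕ) : Set (EuclideanSpace ℝ (Fin d)) :=
  (fun k : ℕ => k • v) '' (Finset.Icc 1 n : Finset ℕ)

theorem isCompact_multiples {d : ℕ} (v : EuclideanSpace ℝ (Fin d)) (n : ℕ) :
    IsCompact (multiples v n) :=
  ((Finset.finite_toSet _).image _).isCompact

theorem iSup_mem_multiples {d : ℕ} (v : EuclideanSpace ℝ (Fin d)) (n : ℕ)
    (f : EuclideanSpace ℝ (Fin d) → ℝ≥0∞) :
    ⨆ y ∈ multiples v n, f y = ⨆ k ∈ Finset.Icc 1 n, f (k • v) := by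
  rw [multiples, iSup_image]
  simp only [Finset.mem_coe]

theorem supOver_multiples_rpow {d : ℕ} (h : EuclideanSpace ℝ (Fin d) → ℝ≥0∞) {ξ : ℝ} (hξ : 0 < ξ)
    (v : EuclideanSpace ℝ (Fin d)) (n : ℕ) (x : EuclideanSpace ℝ (Fin d)) :
    supOver h (multiples v n) x ^ ξ = ⨆ k ∈ Finset.Icc 1 n, h (x + k • v) ^ ξ := by
  rw [supOver_rpow h hξ, supOver, iSup_mem_multiples v n fun z => h (x + z) ^ ξ]

/-- Indices beyond `m` form a block of length `n` translated by `m • v`, which does not change its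
integral; the maximum of the two blocks is at most their sum. -/
theorem lintegral_supOver_multiples_add_le {d : ℕ} {h : EuclideanSpace ℝ (Fin d) → ℝ≥0∞} {ξ : ℝ}
    (hξ : 0 < ξ) (hcont : Continuous h) (v : EuclideanSpace ℝ (Fin d)) (m n : ℕ) :
    (∫⁻ x, supOver h (multiples v (m + n)) x ^ ξ) ≤
      (∫⁻ x, supOver h (multiples v m) x ^ ξ) + ∫⁻ x, supOver h (multiples v n) x ^ ξ := by
  rw [← lintegral_add_right_eq_self (fun x => supOver h (multiples v n) x ^ ξ) (m • v),
    ← lintegral_add_left ((measurable_supOver hcont _).pow_const ξ)]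
  refine lintegral_mono fun x => ?_
  simp only [supOver_multiples_rpow h hξ]
  refine iSup₂_le fun k hk => ?_
  rw [Finset.mem_Icc] at hk
  rcases le_or_gt k m with hkm | hkm
  · exact le_add_right (le_iSup₂_of_le k (Finset.mem_Icc.2 ⟨hk.1, hkm⟩) le_rfl)
  · refine le_add_left (le_iSup₂_of_le (k - m) (Finset.mem_Icc.2 (by omega)) (le_of_eq ?_))
    obtain ⟨j, rfl⟩ := Nat.exists_eq_add_of_lt hkm
    have : m + j + 1 - m = j + 1 := by omega
    rw [this, add_assoc x, ← add_nsmul, add_assoc m]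

/-- A subadditive sequence of finite extended nonnegative numbers has a mean limit, equal to the
infimum of its means. -/
theorem tendsto_toReal_div_of_subadditive {I : ℕ → ℝ≥0∞} (hfin : ∀ n, I n ≠ ⊤)
    (hsub : ∀ m n, I (m + n) ≤ I m + I n) :
    Tendsto (fun n : ℕ => (I n).toReal / n) atTop
      (𝓝 (⨅ (n : ℕ) (_ : 1 ≤ n), (n : ℝ≥0∞)⁻¹ * I n).toReal) := by
  have hS : Subadditive fun n => (I n).toReal := fun m n => by
    rw [← ENNReal.toReal_add (hfin m) (hfin n)]
    exact ENNReal.toReal_mono (ENNReal.add_ne_top.2 ⟨hfin m, hfin n⟩) (hsub m n)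
  have hbdd : BddBelow (Set.range fun n : ℕ => (I n).toReal / n) :=
    ⟨0, by rintro _ ⟨n, rfl⟩; positivity⟩
  convert hS.tendsto_lim hbdd
  have hlim : hS.lim = sInf ((fun n : ℕ => (I n).toReal / n) '' Set.Ici 1) := by
    rw [Subadditive.lim]
  -- `toReal` passes through an infimum of finite terms only; indexing by the subtype removes `n =
  -- 0`, whose inner infimum is `⊤`.
  rw [hlim, iInf_subtype', ENNReal.toReal_iInf, sInf_image']
  · refine iInf_congr fun n => ?_
    rw [ENNReal.toReal_mul, ENNReal.toReal_inv, ENNReal.toReal_natCast, div_eq_inv_mul]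
  · rintro ⟨n, hn⟩
    refine ENNReal.mul_ne_top (ENNReal.inv_ne_top.2 ?_) (hfin n)
    exact_mod_cast (Nat.one_le_iff_ne_zero.1 hn)

/-! ### The three coefficients -/

theorem proposition4p2 {Ω : Type*} [MeasurableSpace Ω] (P : Measure Ω) [IsProbabilityMeasure P]
    {d : ℕ} (ξ : ℝ) (hξ : 0 < ξ)
    (Φ : Ω → Set (EuclideanSpace ℝ (Fin d) × ℝ))
    (hΦ : IsPoissonPointProcess P (powerMeasure ξ) Φ)
    (h : EuclideanSpace ℝ (Fin d) → ℝ≥0∞) (hcont : Continuous h)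
    (hone : (∫⁻ x, h x ^ ξ) = 1)
    (hplus : (∫⁻ x, supOver h (Metric.closedBall 0 1) x ^ ξ) < ⊤) :
    (∀ K : Set (EuclideanSpace ℝ (Fin d)), IsCompact K →
      (∫⁻ x, supOver h K x ^ ξ) < ⊤ ∧
      ∀ θ : ℝ, IsExtremalCoefficient P (extremalShotNoise h Φ) K θ ↔
        θ = (∫⁻ x, supOver h K x ^ ξ).toReal) ∧
    (∀ l : EuclideanSpace ℝ (Fin d),
      (∫⁻ x, max (h x ^ ξ) (h (x + l) ^ ξ)) < ⊤ ∧
      ∀ θ : ℝ, IsPairwiseExtremalCoefficient P (extremalShotNoise h Φ) l θ ↔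
        θ = (∫⁻ x, max (h x ^ ξ) (h (x + l) ^ ξ)).toReal) ∧
    (∀ v : EuclideanSpace ℝ (Fin d), v ≠ 0 →
      (∀ n : ℕ, (∫⁻ x, ⨆ k ∈ Finset.Icc 1 n, h (x + k • v) ^ ξ) < ⊤) ∧
      ∀ γ : ℝ, IsExtremalIndex P ξ (extremalShotNoise h Φ) v γ ↔
        γ = (⨅ (n : ℕ) (_ : 1 ≤ n),
          (n : ℝ≥0∞)⁻¹ * ∫⁻ x, ⨆ k ∈ Finset.Icc 1 n, h (x + k • v) ^ ξ).toReal) := by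
  have hfin : ∀ {K : Set (EuclideanSpace ℝ (Fin d))}, IsCompact K →
      (∫⁻ x, supOver h K x ^ ξ) < ⊤ := lintegral_supOver_rpow_lt_top hξ hplus hcont
  have hlt : ∀ {K : Set (EuclideanSpace ℝ (Fin d))}, IsCompact K → ∀ {u : ℝ}, 0 < u →
      P.real {ω | (⨆ y ∈ K, extremalShotNoise h Φ ω y) < ENNReal.ofReal u} =
        Real.exp (-(u ^ (-ξ) * (∫⁻ x, supOver h K x ^ ξ).toReal)) := fun hK _ hu =>
    hΦ.measureReal_iSup_lt hξ hcont (hfin hK) hu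
  have hzero : ∀ {u : ℝ}, 0 < u → P.real {ω | extremalShotNoise h Φ ω 0 < ENNReal.ofReal u} =
      Real.exp (-u ^ (-ξ)) := by
    intro u hu
    have := hlt (isCompact_singleton (x := 0)) hu
    simpa [supOver, hone] using this
  refine ⟨fun K hK => ⟨hfin hK, fun θ => ?_⟩, fun l => ?_, fun v _ => ?_⟩
  · constructor
    · intro H
      -- At `u = 1` the margin equals `exp (-1)`, whose powers determine the exponent.
      have := H 1 one_pos
      rw [hlt hK one_pos, hzero one_pos, ← Real.exp_mul, Real.exp_eq_exp] at this
      simp only [Real.one_rpow] at this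
      linarith
    · rintro rfl u hu
      rw [hlt hK hu, hzero hu, ← Real.exp_mul, neg_mul]
  · have hpair : ∀ x, (∫⁻ y, supOver h {x, x + l} y ^ ξ) =
        ∫⁻ y, max (h y ^ ξ) (h (y + l) ^ ξ) := by
      intro x
      -- Translating by `x` shows that the pair integral depends on the lag only.
      rw [← lintegral_add_right_eq_self (fun y => max (h y ^ ξ) (h (y + l) ^ ξ)) x]
      refine lintegral_congr fun y => ?_
      rw [supOver_rpow h hξ, supOver_pair, add_assoc]
    have hcpt : ∀ x : EuclideanSpace ℝ (Fin d), IsCompact {x, x + l} := fun x =>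
      (Set.toFinite _).isCompact
    have hprob : ∀ (x : EuclideanSpace ℝ (Fin d)) {u : ℝ}, 0 < u →
        P.real {ω | extremalShotNoise h Φ ω x < ENNReal.ofReal u ∧
          extremalShotNoise h Φ ω (x + l) < ENNReal.ofReal u} =
        Real.exp (-(u ^ (-ξ) * (∫⁻ y, max (h y ^ ξ) (h (y + l) ^ ξ)).toReal)) := by
      intro x u hu
      rw [← hpair x, ← hlt (hcpt x) hu]
      simp only [iSup_pair, max_lt_iff]
    refine ⟨hpair 0 ▸ hfin (hcpt 0), fun θ => ?_⟩
    constructor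
    · intro H
      have := H 0 1 one_pos
      rw [hprob 0 one_pos, hzero one_pos, ← Real.exp_mul, Real.exp_eq_exp] at this
      simp only [Real.one_rpow] at this
      linarith
    · rintro rfl x u hu
      rw [hprob x hu, hzero hu, ← Real.exp_mul, neg_mul]
  · simp_rw [← supOver_multiples_rpow h hξ v]
    have hI := fun n => hfin (isCompact_multiples v n)
    refine ⟨hI, fun γ => ?_⟩
    set γ₀ := (⨅ (n : ℕ) (_ : 1 ≤ n),
      (n : ℝ≥0∞)⁻¹ * ∫⁻ x, supOver h (multiples v n) x ^ ξ).toReal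
    have hmain : IsExtremalIndex P ξ (extremalShotNoise h Φ) v γ₀ := by
      intro u hu
      have hT := tendsto_toReal_div_of_subadditive (fun n => (hI n).ne)
        (lintegral_supOver_multiples_add_le hξ hcont v)
      have hT' := (Real.continuous_exp.tendsto _).comp (hT.const_mul (u ^ (-ξ))).neg
      rw [frechetCDF, if_pos hu, ← Real.exp_mul, neg_mul]
      refine hT'.congr' ?_
      -- At `n = 0` the level vanishes, and the law is known only at positive levels.
      filter_upwards [eventually_ge_atTop 1] with n hn
      have hn' : (0 : ℝ) < n := by exact_mod_cast hn
      simp_rw [← iSup_mem_multiples v n]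
      rw [hΦ.measureReal_iSup_le hξ hcont (hI n) (by positivity), Function.comp_apply,
        Real.mul_rpow (by positivity) hu.le, ← Real.rpow_mul hn'.le]
      -- The normalisation `n ^ (1/ξ)` contributes exactly the factor `1/n` of the mean.
      have : 1 / ξ * -ξ = -1 := by field_simp
      rw [this, Real.rpow_neg_one]
      congr 2
      field_simp
    constructor
    · intro H
      have := tendsto_nhds_unique (H 1 one_pos) (hmain 1 one_pos)
      rw [frechetCDF, if_pos one_pos, ← Real.exp_mul, ← Real.exp_mul, Real.exp_eq_exp] at this
      simp only [Real.one_rpow] at this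
      linarith
    · rintro rfl
      exact hmain
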